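/- Let $n\ge 0$ be an integer and let $E$ be a countable Borel equivalence relation on $\mathbb{R}^n$, i.e. an equivalence relation that is a Borel subset of $\mathbb{R}^n\times\mathbb{R}^n$ and all of whose classes are countable. An equivalence relation $F$ on a closed set $A\subseteq\mathbb{R}^n$ is called smooth if there is a Borel function $f\colon A\to\mathbb{R}$ such that $x\mathrel{F}y\iff f(x)=f(y)$ for all $x,y\in A$. A gauge function is a (weakly) increasing, right-continuous function $g\colon[0,\infty)\to[0,\infty)$ with $g(0)=0$ and $g(t)>0$ for $t>0$; it is of lower order than $t\mapsto t^n$ if $\lim_{t\to0^+}t^n/g(t)=0$. With respect to the Euclidean metric on $\mathbb{R}^n$, put $$H^g(A)=\lim_{\delta\to0^+}\ \inf\Big\{\sum_{i=0}^\infty g(\operatorname{diam}U_i) : (U_i)_{i\in\mathbb{N}}\text{ is a cover of }A\text{ by open sets of diameter}<\delta\Big\}.$$ Then: 1. for every gauge function $g$ of lower order than $t\mapsto t^n$ there is a closed set $A\subseteq[0,1]^n$ such that the restriction $E\restriction A$ is smooth and $H^g(A)>0$; 2. there is a closed set $A\subseteq[0,1]^n$ of Hausdorff dimension $n$ such that $E\restriction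 A$ is smooth. -/

import Mathlib

open Filter Topology MeasureTheory
open scoped NNReal ENNReal

/-- A gauge function `g : [0,∞) → [0,∞)`: increasing (in the weak sense), continuous on the right,
`g 0 = 0`, and `g t > 0` for `t > 0`. -/
structure IsGauge (g : ℝ≥0 → ℝ≥0) : Prop where
  monotone : Monotone g
  rightContinuous : ∀ t, ContinuousWithinAt g (Set.Ici t) t
  map_zero : g 0 = 0
  pos : ∀ t, 0 < t → 0 < g t

/-- `f` has lower order than `g` (equivalently, `g` has higher order than `f`):
`g t / f t → 0` as `t → 0⁺`. -/
def LowerOrder (f g : ℝ≥0 → ℝ≥0) : Prop :=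
  Tendsto (fun t => g t / f t) (𝓝[>] 0) (𝓝 0)

/-- `H^g_δ(A)`: the infimum of `∑ g (diam (U i))` over the countable covers `(U i)` of `A` by open
sets of diameter `< δ`. Diameters are `< δ < ∞`, so that `toNNReal` loses nothing. -/
noncomputable def gaugePreMeasure {X : Type*} [PseudoEMetricSpace X] (g : ℝ≥0 → ℝ≥0) (δ : ℝ≥0)
    (A : Set X) : ℝ≥0∞ :=
  ⨅ (U : ℕ → Set X) (_ : ∀ i, IsOpen (U i)) (_ : A ⊆ ⋃ i, U i)
    (_ : ∀ i, Metric.ediam (U i) < (δ : ℝ≥0∞)),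
    ∑' i, (g (Metric.ediam (U i)).toNNReal : ℝ≥0∞)

/-- The `g`-measure `H^g(A) = lim_{δ → 0⁺} H^g_δ(A)`. As `H^g_δ(A)` increases when `δ` decreases,
the limit is the supremum over `δ > 0`. -/
noncomputable def gaugeMeasure {X : Type*} [PseudoEMetricSpace X] (g : ℝ≥0 → ℝ≥0)
    (A : Set X) : ℝ≥0∞ :=
  ⨆ (δ : ℝ≥0) (_ : 0 < δ), gaugePreMeasure g δ A

/-- The limit in the definition of the `g`-measure exists and is the supremum. -/
theorem tendsto_gaugePreMeasure {X : Type*} [PseudoEMetricSpace X] (g : ℝ≥0 → ℝ≥0) (A : Set X) :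
    Tendsto (fun δ => gaugePreMeasure g δ A) (𝓝[>] 0) (𝓝 (gaugeMeasure g A)) := by
  have hanti : Antitone (fun δ => gaugePreMeasure g δ A) := by
    intro δ ε h
    refine le_iInf fun U => le_iInf fun hU => le_iInf fun hA => le_iInf fun hd => ?_
    exact iInf_le_of_le U (iInf_le_of_le hU (iInf_le_of_le hA (iInf_le_of_le
      (fun i => (hd i).trans_le (by exact_mod_cast h)) le_rfl)))
  rw [tendsto_order]
  constructor
  · intro a ha
    obtain ⟨δ, hδ, h⟩ : ∃ δ : ℝ≥0, 0 < δ ∧ a < gaugePreMeasure g δ A := by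
      simpa [gaugeMeasure, lt_iSup_iff] using ha
    filter_upwards [Ioo_mem_nhdsGT hδ] with ε hε
    exact h.trans_le (hanti hε.2.le)
  · intro a ha
    filter_upwards [self_mem_nhdsWithin] with ε hε
    exact lt_of_le_of_lt (le_iSup₂_of_le ε hε le_rfl) ha

/-- A countable Borel equivalence relation: it is Borel as a subset of `X × X` and all of its
classes are countable. -/
structure IsCountableBorel {X : Type*} [MeasurableSpace X] (E : Setoid X) : Prop where
  measurableSet : MeasurableSet {p : X × X | E p.1 p.2}
  countable : ∀ x, {y | E y x}.Countable

/-- Borel reducibility `E ≤_B F` of equivalence relations. -/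
def BorelReducible {X Y : Type*} [MeasurableSpace X] [MeasurableSpace Y] (E : Setoid X)
    (F : Setoid Y) : Prop :=
  ∃ f : X → Y, Measurable f ∧ ∀ x₀ x₁, E x₀ x₁ ↔ F (f x₀) (f x₁)

/-- `E` is smooth: it is Borel reducible to equality on `ℝ`. -/
def IsSmooth {X : Type*} [MeasurableSpace X] (E : Setoid X) : Prop :=
  BorelReducible E (⊥ : Setoid ℝ)

/-- The restriction of the equivalence relation `E` to the set `A`. -/
def restrictSetoid {X : Type*} (E : Setoid X) (A : Set X) : Setoid A :=
  E.comap Subtype.val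

/-- The unit cube `[0,1]^n` in `ℝ^n`. -/
def unitCube (n : ℕ) : Set (EuclideanSpace ℝ (Fin n)) :=
  {x | ∀ i, x i ∈ Set.Icc (0 : ℝ) 1}

/-! It suffices to find a compact `A` that meets each class in at most one point, since `E` is then
equality on `A`. Over a conull set, `E` off the diagonal is covered by countably many partial
injections `T k` (`IsCountableBorel.exists_partialInjections`, from an almost everywhere form of
Lusin–Novikov), so `A` only has to avoid them all while remaining large for `g`.

One `T` is avoided by cutting it into pieces between cells of tiny measure and deleting either the
domain or the range of each piece. A random choice deletes about half of any given set; since the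
pieces are tiny the variance is small, so one choice serves finitely many sets at once
(`exists_choice_measureReal_le`, with signs in place of probability). Rescaling what is left
restores the mass of every cell of a given finite partition and multiplies the measure by at most 8
(`IsPartialInjection.exists_concentrated`).

Iteration starts from Lebesgue measure on a compact set and uses dyadic partitions of side `2 ^ (-m
k)`. It gives measures `ν k` with `ν k ≤ 8 ^ k • volume`, concentrated on closed sets that avoid `T
0, …, T (k - 1)`, and masses of dyadic cubes fixed from their stage on. As `t ^ n / g t → 0`, the `m
k` can grow so fast that the factor `8 ^ k` is absorbed by `g`: then `ν k U ≤ 4 ^ n * g (diam U)`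
for all `k` and all small `U`. This is the mass distribution principle; compactness replaces a limit
measure.

For dimension `n`, take `g t = t ^ n * (1 + |log t|)`, which lies below `t ^ s` near `0` for each `s
< n`. -/

/-! ### Universal measurability of analytic sets -/

section Analytic

variable {α : Type*} [TopologicalSpace α] [T2Space α]

/-- The image of a product of initial segments under a continuous map on the Baire space contains
the intersection of the closures of the images of its finite stages. -/
theorem iInter_closure_image_subset {f : (ℕ → ℕ) → α} (hf : Continuous f) (b : ℕ → ℕ) :
    ⋂ k, closure (f '' {σ | ∀ i < k, σ i ≤ b i}) ⊆ f '' Set.pi Set.univ fun i => Set.Iic (b i) := by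
  intro x hx
  by_contra hxK
  have hK : IsCompact (Set.pi Set.univ fun i => Set.Iic (b i)) :=
    isCompact_univ_pi fun i => (Set.finite_Iic (b i)).isCompact
  obtain ⟨V, W, hV, hW, hKV, hxW, hVW⟩ :=
    SeparatedNhds.of_isCompact_isCompact (hK.image hf) (isCompact_singleton (x := x))
      (Set.disjoint_singleton_right.2 hxK)
  have hcyl : ∀ τ ∈ Set.pi Set.univ fun i => Set.Iic (b i),
      ∃ k, PiNat.cylinder τ k ⊆ f ⁻¹' V := by
    intro τ hτ
    exact (PiNat.isTopologicalBasis_cylinders (fun _ => ℕ)).mem_nhds_iff.1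
      ((hV.preimage hf).mem_nhds (hKV ⟨τ, hτ, rfl⟩)) |>.elim (by
        rintro _ ⟨⟨y, n, rfl⟩, hy, hsub⟩
        exact ⟨n, by rwa [PiNat.mem_cylinder_iff_eq.1 hy]⟩)
  choose! k hk using hcyl
  obtain ⟨t, htK, ht⟩ := hK.elim_nhds_subcover (fun τ => PiNat.cylinder τ (k τ))
    fun τ _ => (PiNat.isOpen_cylinder _ τ _).mem_nhds (PiNat.self_mem_cylinder τ _)
  have hsub : f '' {σ | ∀ i < t.sup k, σ i ≤ b i} ⊆ V := by
    rintro _ ⟨σ, hσ, rfl⟩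
    -- Truncating `σ` to `min σ b` gives a point of the compact product that agrees with `σ` on the
    -- first `t.sup k` coordinates, hence lies in the same cylinder of the subcover.
    obtain ⟨τ, hτ, hστ⟩ := Set.mem_iUnion₂.1 (ht (show (fun i => min (σ i) (b i)) ∈ _ from
      fun i _ => Set.mem_Iic.2 (min_le_right _ _)))
    refine hk τ (htK τ hτ) fun i hi => ?_
    rw [← hστ i hi]
    exact (min_eq_left (hσ i (hi.trans_le (Finset.le_sup (f := k) hτ)))).symm
  have := mem_closure_iff.1 (Set.mem_iInter.1 hx (t.sup k)) W hW (hxW rfl)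
  obtain ⟨y, hyW, hy⟩ := this
  exact Set.disjoint_left.1 hVW (hsub hy) hyW

variable [MeasurableSpace α] [BorelSpace α]

/-- A continuous image of the Baire space is inner regular for compact sets. -/
theorem exists_isCompact_subset_range_le_measure (μ : Measure α) [IsFiniteMeasure μ]
    {f : (ℕ → ℕ) → α} (hf : Continuous f) {c : ℝ≥0∞} (hc : c < μ (Set.range f)) :
    ∃ K ⊆ Set.range f, IsCompact K ∧ c ≤ μ K := by
  -- Continuity from below holds for increasing unions of arbitrary sets, so bounding one more
  -- coordinate keeps the outer measure of the image above `c`.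
  have hstep : ∀ (k : ℕ) (s : {s : Set (ℕ → ℕ) // c < μ (f '' s)}),
      ∃ m : ℕ, c < μ (f '' (s.1 ∩ {σ | σ k ≤ m})) := by
    rintro k ⟨s, hs⟩
    have hmono : Monotone fun m : ℕ => f '' (s ∩ {σ | σ k ≤ m}) := fun m m' h =>
      Set.image_mono fun σ hσ => ⟨hσ.1, le_trans hσ.2 h⟩
    have hU : ⋃ m : ℕ, f '' (s ∩ {σ | σ k ≤ m}) = f '' s := by
      rw [← Set.image_iUnion, ← Set.inter_iUnion]
      congr 1
      exact Set.inter_eq_left.2 fun σ _ => Set.mem_iUnion.2 ⟨σ k, le_refl (σ k)⟩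
    have := hmono.measure_iUnion (μ := μ)
    rw [hU] at this
    exact lt_iSup_iff.1 (this ▸ hs)
  choose m hm using hstep
  let S : ℕ → {s : Set (ℕ → ℕ) // c < μ (f '' s)} := fun k =>
    Nat.rec ⟨Set.univ, by rwa [Set.image_univ]⟩ (fun k s => ⟨_, hm k s⟩) k
  let b : ℕ → ℕ := fun k => m k (S k)
  have hS : ∀ k, (S k).1 = {σ | ∀ i < k, σ i ≤ b i} := by
    intro k
    induction k with
    | zero => simp [S]
    | succ k ih =>
      change (S k).1 ∩ {σ | σ k ≤ b k} = _
      rw [ih]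
      ext σ
      simp only [Set.mem_inter_iff, Set.mem_ofPred_eq, Nat.lt_succ_iff_lt_or_eq]
      exact ⟨fun h i hi => hi.elim (h.1 i) (fun e => e ▸ h.2),
        fun h => ⟨fun i hi => h i (Or.inl hi), h k (Or.inr rfl)⟩⟩
  refine ⟨f '' Set.pi Set.univ fun i => Set.Iic (b i), Set.image_subset_range _ _,
    (isCompact_univ_pi fun i => (Set.finite_Iic (b i)).isCompact).image hf, ?_⟩
  refine le_trans ?_ (measure_mono (iInter_closure_image_subset hf b))
  have hanti : Antitone fun k => closure (f '' {σ | ∀ i < k, σ i ≤ b i}) := fun k l h =>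
    closure_mono (Set.image_mono fun σ hσ i hi => hσ i (hi.trans_le h))
  rw [hanti.measure_iInter (fun k => isClosed_closure.nullMeasurableSet)
    ⟨0, measure_ne_top _ _⟩]
  refine le_iInf fun k => le_trans ?_ (measure_mono subset_closure)
  rw [← hS k]
  exact (S k).2.le

/-- Analytic sets are universally measurable. -/
theorem MeasureTheory.AnalyticSet.nullMeasurableSet {s : Set α} (hs : AnalyticSet s)
    (μ : Measure α) [IsFiniteMeasure μ] : NullMeasurableSet s μ := by
  rw [AnalyticSet] at hs
  rcases hs with rfl | ⟨f, hf, rfl⟩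
  · exact nullMeasurableSet_empty
  rcases eq_or_ne (μ (Set.range f)) 0 with h0 | h0
  · exact NullMeasurableSet.of_null h0
  obtain ⟨u, -, hu, hlim⟩ := exists_seq_strictMono_tendsto' (pos_iff_ne_zero.2 h0)
  choose K hKs hK hKu using fun n => exists_isCompact_subset_range_le_measure μ hf (hu n).2
  have hmeas : MeasurableSet (⋃ n, K n) := MeasurableSet.iUnion fun n => (hK n).measurableSet
  have hsub : ⋃ n, K n ⊆ Set.range f := Set.iUnion_subset hKs
  have hle : μ (Set.range f) ≤ μ (⋃ n, K n) := le_of_tendsto' hlim fun n =>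
    (hKu n).trans (measure_mono (Set.subset_iUnion K n))
  have := ae_eq_of_subset_of_measure_ge hsub hle hmeas.nullMeasurableSet (measure_ne_top _ _)
  exact hmeas.nullMeasurableSet.congr this

end Analytic

/-! ### Lusin–Novikov almost everywhere, and partial injections -/

section Uniformization

/-- A set without isolated points which lies in a closed countable set is empty. -/
theorem Preperfect.eq_empty_of_subset_of_isClosed_of_countable {α : Type*} [TopologicalSpace α]
    [PolishSpace α] {R C : Set α} (hR : Preperfect R) (hRC : R ⊆ C) (hC : IsClosed C)
    (hCc : C.Countable) : R = ∅ := by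
  by_contra hne
  have hcard : Cardinal.aleph0 < Cardinal.mk (ℕ → Bool) := by
    simp [Cardinal.aleph0_lt_continuum]
  let _ := TopologicalSpace.upgradeIsCompletelyMetrizable α
  obtain ⟨f, hf, -, hinj⟩ := hR.perfect_closure.exists_nat_bool_injection
    (Set.nonempty_iff_ne_empty.2 hne).closure
  have : (Set.range f).Countable := hCc.mono (hf.trans (closure_minimal hRC hC))
  have h2 : Countable (ℕ → Bool) := by
    rw [← Set.countable_univ_iff]
    exact Set.countable_of_injective_of_countable_image hinj.injOn (by rwa [Set.image_univ])
  exact (Cardinal.mk_le_aleph0_iff.2 h2).not_gt hcard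

variable {X Z : Type*} [MeasurableSpace X] [MeasurableSpace Z]

/-- `S` is a countable union of measurable sets on which `π` is injective. -/
def IsCountableUnionOfSections (π : Z → X) (S : Set Z) : Prop :=
  ∃ T : ℕ → Set Z, (∀ k, MeasurableSet (T k) ∧ Set.InjOn π (T k)) ∧ S = ⋃ k, T k

omit [MeasurableSpace X] in
theorem IsCountableUnionOfSections.measurableSet {π : Z → X} {S : Set Z}
    (h : IsCountableUnionOfSections π S) : MeasurableSet S := by
  obtain ⟨T, hT, rfl⟩ := h
  exact MeasurableSet.iUnion fun k => (hT k).1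

omit [MeasurableSpace X] in
theorem IsCountableUnionOfSections.iUnion {π : Z → X} {S : ℕ → Set Z}
    (h : ∀ k, IsCountableUnionOfSections π (S k)) : IsCountableUnionOfSections π (⋃ k, S k) := by
  choose T hT hS using h
  refine ⟨fun k => T k.unpair.1 k.unpair.2, fun k => hT _ _, ?_⟩
  simp_rw [hS]
  exact (Set.iUnion_unpair T).symm

omit [MeasurableSpace X] in
theorem isCountableUnionOfSections_of_injOn {π : Z → X} {T : Set Z} (hT : MeasurableSet T)
    (hinj : Set.InjOn π T) : IsCountableUnionOfSections π T :=
  ⟨fun _ => T, fun _ => ⟨hT, hinj⟩, (Set.iUnion_const T).symm⟩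

omit [MeasurableSpace X] in
theorem IsCountableUnionOfSections.union {π : Z → X} {S T : Set Z}
    (hS : IsCountableUnionOfSections π S) (hT : IsCountableUnionOfSections π T) :
    IsCountableUnionOfSections π (S ∪ T) := by
  have := IsCountableUnionOfSections.iUnion (π := π) (S := fun k => if k = 0 then S else T)
    fun k => by split_ifs <;> assumption
  convert this using 1
  ext p
  simp only [Set.mem_union, Set.mem_iUnion]
  constructor
  · rintro (h | h)
    exacts [⟨0, by simpa using h⟩, ⟨1, by simpa using h⟩]
  · rintro ⟨k, h⟩
    split_ifs at h
    exacts [Or.inl h, Or.inr h]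

/-- Some countable union of sections minimizes simultaneously the measures of the projections of
the remainders of countably many sets. -/
theorem exists_isCountableUnionOfSections_minimal (μ : Measure X) (π : Z → X) (U : ℕ → Set Z) :
    ∃ S, IsCountableUnionOfSections π S ∧ ∀ n, ∀ S', IsCountableUnionOfSections π S' →
      μ (π '' (U n \ S)) ≤ μ (π '' (U n \ S')) := by
  have hne : {S : Set Z | IsCountableUnionOfSections π S}.Nonempty :=
    ⟨∅, isCountableUnionOfSections_of_injOn .empty (Set.injOn_empty _)⟩
  have hseq : ∀ n, ∃ S : ℕ → Set Z, (∀ j, IsCountableUnionOfSections π (S j)) ∧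
      ∀ S', IsCountableUnionOfSections π S' →
        ⨅ j, μ (π '' (U n \ S j)) ≤ μ (π '' (U n \ S')) := by
    intro n
    obtain ⟨u, -, hlim, hu⟩ := exists_seq_tendsto_sInf
      (hne.image fun S => μ (π '' (U n \ S))) (OrderBot.bddBelow _)
    choose S hS hSu using hu
    refine ⟨S, hS, fun S' hS' => ?_⟩
    refine le_trans ?_ (sInf_le (Set.mem_image_of_mem (fun S => μ (π '' (U n \ S)))
      (show S' ∈ {S : Set Z | IsCountableUnionOfSections π S} from hS')))
    refine ge_of_tendsto' hlim fun j => ?_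
    rw [← hSu j]
    exact iInf_le (fun j => μ (π '' (U n \ S j))) j
  choose S hS hmin using hseq
  -- Enlarging the union of sections only shrinks the remainders, so the union of the minimizing
  -- sequences for all `n` is minimal for every `n`.
  refine ⟨⋃ n, ⋃ j, S n j, .iUnion fun n => .iUnion fun j => hS n j, fun n S' hS' => ?_⟩
  refine le_trans (le_iInf fun j => measure_mono (Set.image_mono ?_)) (hmin n S' hS')
  exact Set.sdiff_subset_sdiff_right ((Set.subset_iUnion (S n) j).trans
    (Set.subset_iUnion (fun n => ⋃ j, S n j) n))

variable [TopologicalSpace X] [PolishSpace X] [BorelSpace X]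

/-- The set of the points with at least two preimages in a Borel set is analytic. -/
theorem analyticSet_two_le_fiber [StandardBorelSpace Z] {π : Z → X} (hπ : Measurable π) {W : Set Z}
    (hW : MeasurableSet W) :
    AnalyticSet {x | ∃ z ∈ W, ∃ z' ∈ W, z ≠ z' ∧ π z = x ∧ π z' = x} := by
  have hm : MeasurableSet {q : Z × Z | q.1 ∈ W ∧ q.2 ∈ W ∧ q.1 ≠ q.2 ∧ π q.1 = π q.2} :=
    (measurable_fst hW).inter ((measurable_snd hW).inter
      ((measurableSet_eq_fun measurable_fst measurable_snd).compl.inter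
        (measurableSet_eq_fun (f := fun q : Z × Z => π q.1) (g := fun q : Z × Z => π q.2)
          (by fun_prop) (by fun_prop))))
  convert hm.analyticSet_image (f := fun q => π q.1) (by fun_prop) using 1
  ext x
  constructor
  · rintro ⟨z, hz, z', hz', hne, rfl, h⟩
    exact ⟨(z, z'), ⟨hz, hz', hne, h.symm⟩, rfl⟩
  · rintro ⟨⟨z, z'⟩, ⟨hz, hz', hne, h⟩, rfl⟩
    exact ⟨z, hz, z', hz', hne, rfl, h.symm⟩

/-- Take a minimal union of sections `S`. If a nonnull set of points had exactly one preimage in `U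
n \ S`, adding these preimages to `S` would contradict minimality. So almost every fiber has a
remainder without isolated points; lying in a closed countable fiber, it is empty. -/
theorem Continuous.exists_sections_of_countable_fibers [TopologicalSpace Z] [PolishSpace Z]
    [BorelSpace Z] (μ : Measure X) [IsFiniteMeasure μ] {π : Z → X} (hπ : Continuous π)
    (hc : ∀ x, (π ⁻¹' {x}).Countable) :
    ∃ T : ℕ → Set Z, (∀ k, MeasurableSet (T k) ∧ Set.InjOn π (T k)) ∧
      ∀ᵐ x ∂μ, ∀ z, π z = x → ∃ k, z ∈ T k := by
  obtain ⟨U, hU⟩ := TopologicalSpace.exists_seq_basis Z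
  have hUm : ∀ n, MeasurableSet (U n) := fun n => (hU.isOpen ⟨n, rfl⟩).measurableSet
  obtain ⟨S, hS, hmin⟩ := exists_isCountableUnionOfSections_minimal μ π U
  have hkey : ∀ n, ∀ᵐ x ∂μ, x ∈ π '' (U n \ S) →
      ∃ z ∈ U n \ S, ∃ z' ∈ U n \ S, z ≠ z' ∧ π z = x ∧ π z' = x := by
    intro n
    have hW : MeasurableSet (U n \ S) := (hUm n).diff hS.measurableSet
    set W := U n \ S with hWdef
    have hA : NullMeasurableSet (π '' W) μ :=
      (hW.analyticSet_image hπ.measurable).nullMeasurableSet μ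
    -- `V` is a Borel set that fills almost all of the set of points with exactly one preimage in
    -- `W`.
    obtain ⟨V, hVsub, hV, hVae⟩ := (hA.diff ((analyticSet_two_le_fiber hπ.measurable
      hW).nullMeasurableSet μ)).exists_measurable_subset_ae_eq
    have hinj : Set.InjOn π (W ∩ π ⁻¹' V) := by
      intro z hz z' hz' h
      by_contra hne
      exact (hVsub hz.2).2 ⟨z, hz.1, z', hz'.1, hne, rfl, h.symm⟩
    have h1 := hmin n _ (hS.union (isCountableUnionOfSections_of_injOn
      (hW.inter (hπ.measurable hV)) hinj))
    have h2 : π '' (U n \ (S ∪ W ∩ π ⁻¹' V)) ⊆ π '' W \ V := by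
      rintro _ ⟨z, ⟨hzU, hz⟩, rfl⟩
      have hzW : z ∈ W := ⟨hzU, fun h => hz (Or.inl h)⟩
      exact ⟨⟨z, hzW, rfl⟩, fun h => hz (Or.inr ⟨hzW, h⟩)⟩
    have h3 : μ (π '' W) ≤ μ (π '' W \ V) := h1.trans (measure_mono h2)
    have hV0 : μ V = 0 := by
      have h4 := measure_inter_add_sdiff (μ := μ) (π '' W) hV
      rw [Set.inter_eq_right.2 (hVsub.trans Set.sdiff_subset)] at h4
      have h5 : μ V + μ (π '' W \ V) ≤ 0 + μ (π '' W \ V) := by rw [h4, zero_add]; exact h3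
      exact le_zero_iff.1 ((ENNReal.add_le_add_iff_right (measure_ne_top _ _)).1 h5)
    have h0 := (measure_congr hVae).symm.trans hV0
    filter_upwards [measure_eq_zero_iff_ae_notMem.1 h0] with x hx hxW
    by_contra hcon
    exact hx ⟨hxW, hcon⟩
  obtain ⟨T, hT, hST⟩ := hS
  refine ⟨T, hT, ?_⟩
  filter_upwards [ae_all_iff.2 hkey] with x hx z hz
  rw [← Set.mem_iUnion, ← hST]
  by_contra hzS
  have hR : Preperfect (π ⁻¹' {x} \ S) := by
    rw [preperfect_iff_nhds]
    rintro w ⟨hwx, hwS⟩ N hN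
    obtain ⟨_, ⟨n, rfl⟩, hwn, hsub⟩ := hU.mem_nhds_iff.1 hN
    obtain ⟨a, ha, b, hb, hab, hax, hbx⟩ := hx n ⟨w, ⟨hwn, hwS⟩, hwx⟩
    by_cases haw : a = w
    · exact ⟨b, ⟨hsub hb.1, hbx, hb.2⟩, fun h => hab (haw.trans h.symm)⟩
    · exact ⟨a, ⟨hsub ha.1, hax, ha.2⟩, haw⟩
  have := hR.eq_empty_of_subset_of_isClosed_of_countable Set.sdiff_subset
    (isClosed_singleton.preimage hπ) (hc x)
  exact this.subset ⟨hz, hzS⟩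

/-- Almost everywhere version of the Lusin–Novikov theorem: a Borel map with countable fibers has
countably many Borel sections which cover almost all of its fibers. -/
theorem Measurable.exists_sections_of_countable_fibers [StandardBorelSpace Z] (μ : Measure X)
    [IsFiniteMeasure μ] {π : Z → X} (hπ : Measurable π) (hc : ∀ x, (π ⁻¹' {x}).Countable) :
    ∃ T : ℕ → Set Z, (∀ k, MeasurableSet (T k) ∧ Set.InjOn π (T k)) ∧
      ∀ᵐ x ∂μ, ∀ z, π z = x → ∃ k, z ∈ T k := by
  -- A finer Polish topology on `Z` with the same Borel sets makes `π` continuous.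
  obtain ⟨t, htb, htp⟩ := ‹StandardBorelSpace Z›.polish
  obtain ⟨t', ht', hcont, hpol⟩ := hπ.exists_continuous
  have hb : @BorelSpace Z t' _ :=
    @BorelSpace.mk Z t' _ (htb.measurable_eq.trans
      (borel_eq_borel_of_le hpol htp ht').symm)
  exact @Continuous.exists_sections_of_countable_fibers X Z _ _ _ _ _ t' hpol hb μ _ π hcont hc

/-- A partial injection which maps a subset of `B` into the complement of `B`, given by its graph:
both projections are injective on `T`. -/
structure IsPartialInjection (T : Set (X × X)) (B : Set X) : Prop where
  measurableSet : MeasurableSet T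
  measurableSet_left : MeasurableSet B
  injOn_fst : Set.InjOn Prod.fst T
  injOn_snd : Set.InjOn Prod.snd T
  fst_mem : ∀ p ∈ T, p.1 ∈ B
  snd_notMem : ∀ p ∈ T, p.2 ∉ B

/-- Over a conull set, a countable Borel equivalence relation is, off the diagonal, a countable
union of partial injections without fixed points. -/
theorem IsCountableBorel.exists_partialInjections {E : Setoid X} (hE : IsCountableBorel E)
    (μ : Measure X) [IsFiniteMeasure μ] :
    ∃ (T : ℕ → Set (X × X)) (B : ℕ → Set X), (∀ k, IsPartialInjection (T k) (B k)) ∧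
      ∃ G, MeasurableSet G ∧ μ Gᶜ = 0 ∧ ∀ x ∈ G, ∀ y ∈ G, E x y → x ≠ y → ∃ k, (x, y) ∈ T k := by
  have := hE.measurableSet.standardBorel
  obtain ⟨T, hT, hTcov⟩ := Measurable.exists_sections_of_countable_fibers μ
    (Z := {p : X × X | E p.1 p.2}) (π := fun p => p.1.1) (by fun_prop) (by
      intro x
      refine Set.MapsTo.countable_of_injOn (f := fun p => p.1.2) (t := {y | E y x}) ?_ ?_
        (hE.countable x)
      · rintro ⟨⟨a, b⟩, hab⟩ rfl
        exact E.symm hab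
      · rintro ⟨⟨a, b⟩, hab⟩ rfl ⟨⟨a', b'⟩, hab'⟩ h h2
        simp_all)
  obtain ⟨D, hD, hsep⟩ := exists_seq_separating X MeasurableSet.empty Set.univ
  let P : ℕ → Set (X × X) := fun k => Subtype.val '' T k
  have hP : ∀ k, MeasurableSet (P k) := fun k => hE.measurableSet.subtype_image (hT k).1
  have hPinj : ∀ k, Set.InjOn Prod.fst (P k) := by
    rintro k _ ⟨p, hp, rfl⟩ _ ⟨q, hq, rfl⟩ h
    exact congrArg _ ((hT k).2 hp hq h)
  -- The index `k` codes `(i, j, l, e)`: `P i` makes the first projection injective, the transpose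
  -- of `P j` the second, and `B k` is `D l` or its complement according to `e`, which separates
  -- domain from range.
  let B : ℕ → Set X := fun k => if k.unpair.2.unpair.2.unpair.2 = 0
    then D k.unpair.2.unpair.2.unpair.1 else (D k.unpair.2.unpair.2.unpair.1)ᶜ
  have hB : ∀ k, MeasurableSet (B k) := by
    intro k
    simp only [B]
    split_ifs
    exacts [hD _, (hD _).compl]
  refine ⟨fun k => (P k.unpair.1 ∩ Prod.swap ⁻¹' P k.unpair.2.unpair.1) ∩ B k ×ˢ (B k)ᶜ, B,
    fun k => ⟨?_, hB k, ?_, ?_, fun p hp => hp.2.1, fun p hp => hp.2.2⟩, ?_⟩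
  · exact ((hP _).inter (measurable_swap (hP _))).inter ((hB k).prod (hB k).compl)
  · exact (hPinj _).mono fun p hp => hp.1.1
  · intro p hp q hq h
    exact Prod.swap_injective (hPinj _ hp.1.2 hq.1.2 h)
  obtain ⟨N, hNsub, hN, hN0⟩ := exists_measurable_superset_of_null (ae_iff.1 hTcov)
  refine ⟨Nᶜ, hN.compl, by rwa [compl_compl], fun x hx y hy hxy hne => ?_⟩
  have hcov : ∀ x ∉ N, ∀ y, E x y → ∃ k, (x, y) ∈ P k := by
    intro x hx y hxy
    by_contra hcon
    refine hx (hNsub fun h => hcon ?_)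
    obtain ⟨k, hk⟩ := h ⟨(x, y), hxy⟩ rfl
    exact ⟨k, _, hk, rfl⟩
  obtain ⟨i, hi⟩ := hcov x hx y hxy
  obtain ⟨j, hj⟩ := hcov y hy x (E.symm hxy)
  obtain ⟨l, hl⟩ : ∃ l, ¬ (x ∈ D l ↔ y ∈ D l) := by
    by_contra! h
    exact hne (hsep x trivial y trivial h)
  obtain ⟨e, he⟩ : ∃ e, (x, y) ∈ B (Nat.pair i (Nat.pair j (Nat.pair l e))) ×ˢ
      (B (Nat.pair i (Nat.pair j (Nat.pair l e))))ᶜ := by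
    by_cases hxl : x ∈ D l
    · exact ⟨0, by simpa [B, hxl] using hl⟩
    · exact ⟨1, by simpa [B, hxl] using hl⟩
  refine ⟨Nat.pair i (Nat.pair j (Nat.pair l e)), ⟨?_, ?_⟩, he⟩
  · rwa [Nat.unpair_pair]
  · rw [Nat.unpair_pair, Nat.unpair_pair]
    exact hj

end Uniformization

/-! ### Avoiding one partial injection -/

section Thinning

/-- Vectors with suitable signs have a sum whose squared length is at most the sum of the squared
lengths. -/
theorem exists_signs_sum_sq_le {ι J : Type*} (F : Finset ι) (s : Finset J) (v : J → ι → ℝ) :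
    ∃ ε : J → ℝ, (∀ j, ε j = 1 ∨ ε j = -1) ∧
      ∑ i ∈ F, (∑ j ∈ s, ε j * v j i) ^ 2 ≤ ∑ j ∈ s, ∑ i ∈ F, v j i ^ 2 := by
  classical
  induction s using Finset.induction_on with
  | empty => exact ⟨fun _ => 1, fun _ => Or.inl rfl, by simp⟩
  | insert j s hj ih =>
    obtain ⟨ε, hε, hle⟩ := ih
    -- The new sign is chosen so that the cross term in the expanded square is nonpositive.
    obtain ⟨e, he, hen⟩ : ∃ e : ℝ, (e = 1 ∨ e = -1) ∧
        e * ∑ i ∈ F, v j i * ∑ l ∈ s, ε l * v l i ≤ 0 := by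
      rcases le_total (∑ i ∈ F, v j i * ∑ l ∈ s, ε l * v l i) 0 with h | h
      · exact ⟨1, Or.inl rfl, by simpa using h⟩
      · exact ⟨-1, Or.inr rfl, by simpa using h⟩
    have he2 : e ^ 2 = 1 := by rcases he with rfl | rfl <;> norm_num
    refine ⟨Function.update ε j e, fun l => ?_, ?_⟩
    · by_cases h : l = j
      · subst h; simpa using he
      · simpa [h] using hε l
    have hsum : ∀ i, ∑ l ∈ insert j s, Function.update ε j e l * v l i =
        e * v j i + ∑ l ∈ s, ε l * v l i := by
      intro i
      rw [Finset.sum_insert hj, Function.update_self]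
      congr 1
      refine Finset.sum_congr rfl fun l hl => ?_
      rw [Function.update_of_ne (ne_of_mem_of_not_mem hl hj)]
    simp_rw [hsum, Finset.sum_insert hj]
    have hexp : ∑ i ∈ F, (e * v j i + ∑ l ∈ s, ε l * v l i) ^ 2 = ∑ i ∈ F, v j i ^ 2 +
        2 * (e * ∑ i ∈ F, v j i * ∑ l ∈ s, ε l * v l i) +
        ∑ i ∈ F, (∑ l ∈ s, ε l * v l i) ^ 2 := by
      simp_rw [Finset.mul_sum (s := F), ← Finset.sum_add_distrib]
      refine Finset.sum_congr rfl fun i _ => ?_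
      linear_combination (v j i ^ 2) * he2
    rw [hexp]
    linarith

/-- Given pairs `D j true`, `D j false` of small sets, all of them disjoint, one can remove one set
of each pair and keep a fixed proportion of each of finitely many given sets. -/
theorem exists_choice_measureReal_le {X ι J : Type*} [MeasurableSpace X] [Fintype J]
    (ν : Measure X) [IsFiniteMeasure ν] (F : Finset ι) (L : ι → Set X)
    (hL : ∀ i, MeasurableSet (L i)) (D : J → Bool → Set X) (hD : ∀ j b, MeasurableSet (D j b))
    (hdisj : Pairwise fun p q : J × Bool => Disjoint (D p.1 p.2) (D q.1 q.2)) {η : ℝ}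
    (hη0 : 0 ≤ η) (hη : ∀ j b, ν.real (D j b) ≤ η)
    (hsmall : ∀ i ∈ F, ν.real (L i) ≠ 0 → η * (F.card * ν.real Set.univ) ≤ (ν.real (L i) / 2) ^ 2) :
    ∃ c : J → Bool, ∀ i ∈ F, ν.real (L i ∩ ⋃ j, D j (c j)) ≤ 3 / 4 * ν.real (L i) := by
  classical
  set a : J → Bool → ι → ℝ := fun j b i => ν.real (L i ∩ D j b) with ha
  have ha0 : ∀ j b i, 0 ≤ a j b i := fun j b i => measureReal_nonneg
  have haη : ∀ j b i, a j b i ≤ η := fun j b i =>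
    (measureReal_mono Set.inter_subset_right).trans (hη j b)
  have hsum : ∀ i, ∑ j, (a j true i + a j false i) ≤ ν.real (L i) := by
    intro i
    have h1 : ∑ j, (a j true i + a j false i) = ∑ p : J × Bool, ν.real (L i ∩ D p.1 p.2) := by
      rw [Fintype.sum_prod_type]
      simp [ha]
    rw [h1, ← measureReal_biUnion_finset
      (fun p _ q _ hpq => (hdisj hpq).mono Set.inter_subset_right Set.inter_subset_right)
      (fun p _ => (hL i).inter (hD p.1 p.2))]
    exact measureReal_mono (Set.iUnion₂_subset fun p _ => Set.inter_subset_left)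
  obtain ⟨ε, hε, hle⟩ := exists_signs_sum_sq_le F Finset.univ
    (fun j i => a j true i - a j false i)
  refine ⟨fun j => decide (ε j = 1), fun i hi => ?_⟩
  by_cases h0 : ν.real (L i) = 0
  · refine (measureReal_mono Set.inter_subset_left).trans ?_
    rw [h0, mul_zero]
  have hrem : ν.real (L i ∩ ⋃ j, D j (decide (ε j = 1))) ≤
      ∑ j, a j (decide (ε j = 1)) i := by
    rw [Set.inter_iUnion]
    exact measureReal_iUnion_fintype_le _
  -- The first term is at most half of `ν.real (L i)`. The second will be at most a quarter, by the
  -- bound on the signed sum, which gives `3 / 4`.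
  have heq : ∑ j, a j (decide (ε j = 1)) i = (∑ j, (a j true i + a j false i)) / 2 +
      (∑ j, ε j * (a j true i - a j false i)) / 2 := by
    rw [← add_div, ← Finset.sum_add_distrib, Finset.sum_div]
    refine Finset.sum_congr rfl fun j _ => ?_
    rcases hε j with h | h
    · simp [h]
    · have : ¬ ((-1 : ℝ) = 1) := by norm_num
      simp only [h, this, decide_false]
      ring
  -- Both masses lie in `[0, η]`, so their difference is bounded both by `η` and by their sum.
  have hd : ∀ j i, (a j true i - a j false i) ^ 2 ≤ η * (a j true i + a j false i) := by
    intro j i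
    nlinarith [ha0 j true i, ha0 j false i, haη j true i, haη j false i,
      mul_nonneg (ha0 j true i) (ha0 j false i)]
  have hsq : (∑ j, ε j * (a j true i - a j false i)) ^ 2 ≤ (ν.real (L i) / 2) ^ 2 := by
    refine le_trans ?_ (hsmall i hi h0)
    refine (Finset.single_le_sum (f := fun i => (∑ j, ε j * (a j true i - a j false i)) ^ 2)
      (fun i _ => sq_nonneg _) hi).trans (hle.trans ?_)
    rw [Finset.sum_comm]
    have : ∀ i ∈ F, ∑ j, (a j true i - a j false i) ^ 2 ≤ η * ν.real Set.univ := by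
      intro i _
      refine (Finset.sum_le_sum fun j _ => hd j i).trans ?_
      rw [← Finset.mul_sum]
      exact mul_le_mul_of_nonneg_left ((hsum i).trans (measureReal_mono (Set.subset_univ _))) hη0
    refine (Finset.sum_le_sum this).trans ?_
    rw [Finset.sum_const, nsmul_eq_mul]
    exact le_of_eq (by ring)
  have habs := abs_le_of_sq_le_sq' hsq (by have := measureReal_nonneg (μ := ν) (s := L i); linarith)
  have := hsum i
  linarith [habs.2]

/-- A finite measure without atoms and with compact support admits finite partitions into
measurable sets of small measure. -/
theorem exists_finite_partition_measure_le {X : Type*} [TopologicalSpace X] [MeasurableSpace X]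
    [OpensMeasurableSpace X] (ν : Measure X) [ν.OuterRegular] (hν : ∀ x, ν {x} = 0) {C : Set X}
    (hC : IsCompact C) (hνC : ν Cᶜ = 0) {η : ℝ≥0∞} (hη : 0 < η) :
    ∃ (t : Finset X) (w : X → t → Prop), (∀ a, MeasurableSet (w ⁻¹' {a})) ∧
      ∀ a, ν (w ⁻¹' {a}) ≤ η := by
  have hU : ∀ x, ∃ U, x ∈ U ∧ IsOpen U ∧ ν U < η := by
    intro x
    obtain ⟨U, hxU, hUo, hU⟩ := Set.exists_isOpen_lt_of_lt {x} η (by rwa [hν x])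
    exact ⟨U, hxU rfl, hUo, hU⟩
  choose U hxU hUo hUη using hU
  obtain ⟨t, -, ht⟩ := hC.elim_nhds_subcover U fun x _ => (hUo x).mem_nhds (hxU x)
  -- A point is labelled by the members of the subcover that contain it. The label that is false
  -- everywhere occurs only off `C`, on a null set.
  refine ⟨t, fun x u => x ∈ U u, fun a => ?_, fun a => ?_⟩
  · have : Measurable fun (x : X) (u : t) => x ∈ U u :=
      measurable_pi_iff.2 fun u => measurableSet_setOfPred.1 (hUo u).measurableSet
    exact this (measurableSet_singleton a)
  · by_cases h : ∃ u, a u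
    · obtain ⟨u, hu⟩ := h
      refine le_trans (measure_mono ?_) (hUη u).le
      rintro x rfl
      exact hu
    · refine le_trans (measure_mono (t := Cᶜ) ?_) (hνC.trans_le (zero_le))
      rintro x rfl hxC
      obtain ⟨u, hu, hxu⟩ := Set.mem_iUnion₂.1 (ht hxC)
      exact h ⟨⟨u, hu⟩, hxu⟩

variable {X : Type*} [TopologicalSpace X] [PolishSpace X] [MeasurableSpace X] [BorelSpace X]

/-- Given finitely many sets, there is a set which avoids the partial injection `T` and contains at
least a quarter of each of them. -/
theorem IsPartialInjection.exists_avoiding {T : Set (X × X)} {B : Set X}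
    (hT : IsPartialInjection T B) {ι : Type*} (ν : Measure X) [IsFiniteMeasure ν]
    (hν : ∀ x, ν {x} = 0) {C : Set X} (hC : IsCompact C) (hνC : ν Cᶜ = 0) (F : Finset ι)
    (L : ι → Set X) (hL : ∀ i, MeasurableSet (L i)) :
    ∃ Y, MeasurableSet Y ∧ Disjoint (Y ×ˢ Y) T ∧
      ∀ i ∈ F, ν.real (L i) ≤ 4 * ν.real (L i ∩ Y) := by
  classical
  obtain ⟨η, hη, hsmall⟩ : ∃ η : ℝ, 0 < η ∧ ∀ i ∈ F, ν.real (L i) ≠ 0 →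
      η * (F.card * ν.real Set.univ) ≤ (ν.real (L i) / 2) ^ 2 := by
    have : ∀ᶠ η in 𝓝[>] (0 : ℝ), ∀ i ∈ F, ν.real (L i) ≠ 0 →
        η * (F.card * ν.real Set.univ) ≤ (ν.real (L i) / 2) ^ 2 := by
      refine (Filter.eventually_all_finset F).2 fun i _ => ?_
      by_cases h0 : ν.real (L i) = 0
      · exact Eventually.of_forall fun η h => absurd h0 h
      · have hlim : Tendsto (fun η : ℝ => η * (F.card * ν.real Set.univ)) (𝓝[>] 0) (𝓝 0) := by
          have : Tendsto (fun η : ℝ => η * (F.card * ν.real Set.univ)) (𝓝 0)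
              (𝓝 (0 * (F.card * ν.real Set.univ))) := tendsto_id.mul_const _
          rw [zero_mul] at this
          exact this.mono_left nhdsWithin_le_nhds
        filter_upwards [hlim.eventually (ge_mem_nhds (show 0 < (ν.real (L i) / 2) ^ 2 by positivity))]
          with η hη _ using hη
    obtain ⟨η, h1, h2⟩ := (this.and self_mem_nhdsWithin).exists
    exact ⟨η, h2, h1⟩
  obtain ⟨t, w, hw, hwη⟩ := exists_finite_partition_measure_le ν hν hC hνC
    (ENNReal.ofReal_pos.2 hη)
  let P : (t → Prop) × (t → Prop) → Set (X × X) := fun j =>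
    T ∩ (w ⁻¹' {j.1}) ×ˢ (w ⁻¹' {j.2})
  have hPT : ∀ j, P j ⊆ T := fun j => Set.inter_subset_left
  have hP : ∀ j, MeasurableSet (P j) := fun j =>
    hT.measurableSet.inter ((hw j.1).prod (hw j.2))
  have hPeq : ∀ {p j j'}, p ∈ P j → p ∈ P j' → j = j' := by
    rintro p ⟨a, b⟩ ⟨a', b'⟩ h h'
    exact Prod.ext (h.2.1.symm.trans h'.2.1) (h.2.2.symm.trans h'.2.2)
  -- The domain and the range of each piece. They are Borel as injective images, and pairwise
  -- disjoint because domains lie in `B` and ranges outside it.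
  let D : (t → Prop) × (t → Prop) → Bool → Set X := fun j b =>
    if b then Prod.fst '' P j else Prod.snd '' P j
  have hD : ∀ j b, MeasurableSet (D j b) := by
    rintro j (_ | _)
    · exact (hP j).image_of_measurable_injOn measurable_snd (hT.injOn_snd.mono (hPT j))
    · exact (hP j).image_of_measurable_injOn measurable_fst (hT.injOn_fst.mono (hPT j))
  have hdisj : Pairwise fun p q : ((t → Prop) × (t → Prop)) × Bool =>
      Disjoint (D p.1 p.2) (D q.1 q.2) := by
    rintro ⟨j, _ | _⟩ ⟨j', _ | _⟩ hne <;> refine Set.disjoint_left.2 ?_ <;>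
      rintro _ ⟨p, hp, rfl⟩ ⟨q, hq, hpq⟩
    · have := hT.injOn_snd (hPT _ hq) (hPT _ hp) hpq
      subst this
      exact hne (Prod.ext (hPeq hp hq) rfl)
    · exact hT.snd_notMem p (hPT _ hp) (hpq ▸ hT.fst_mem q (hPT _ hq))
    · exact hT.snd_notMem q (hPT _ hq) (hpq ▸ hT.fst_mem p (hPT _ hp))
    · have := hT.injOn_fst (hPT _ hq) (hPT _ hp) hpq
      subst this
      exact hne (Prod.ext (hPeq hp hq) rfl)
  have hDη : ∀ j b, ν.real (D j b) ≤ η := by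
    intro j b
    refine ENNReal.toReal_le_of_le_ofReal hη.le ?_
    cases b
    · refine (measure_mono ?_).trans (hwη j.2)
      rintro _ ⟨p, hp, rfl⟩
      exact hp.2.2
    · refine (measure_mono ?_).trans (hwη j.1)
      rintro _ ⟨p, hp, rfl⟩
      exact hp.2.1
  obtain ⟨c, hc⟩ := exists_choice_measureReal_le ν F L hL D hD hdisj hη.le hDη hsmall
  have hR : MeasurableSet (⋃ j, D j (c j)) := MeasurableSet.iUnion fun j => hD _ _
  refine ⟨(⋃ j, D j (c j))ᶜ, hR.compl, ?_, fun i hi => ?_⟩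
  · rw [Set.disjoint_left]
    rintro p ⟨hp1, hp2⟩ hpT
    -- Each pair of `T` lies in the piece of its own two cells, and one side of that piece was
    -- removed.
    have hpP : p ∈ P (w p.1, w p.2) := ⟨hpT, rfl, rfl⟩
    cases hb : c (w p.1, w p.2)
    · exact hp2 (Set.mem_iUnion.2 ⟨_, by rw [hb]; exact ⟨p, hpP, rfl⟩⟩)
    · exact hp1 (Set.mem_iUnion.2 ⟨_, by rw [hb]; exact ⟨p, hpP, rfl⟩⟩)
  · have h1 := hc i hi
    have h2 := measureReal_inter_add_sdiff (μ := ν) (s := L i) hR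
    rw [Set.sdiff_eq] at h2
    linarith

/-- Closed version of `IsPartialInjection.exists_avoiding`. -/
theorem IsPartialInjection.exists_isClosed_avoiding {T : Set (X × X)} {B : Set X}
    (hT : IsPartialInjection T B) {ι : Type*} (ν : Measure X) [IsFiniteMeasure ν]
    (hν : ∀ x, ν {x} = 0) {C : Set X} (hC : IsCompact C) (hνC : ν Cᶜ = 0) (F : Finset ι)
    (L : ι → Set X) (hL : ∀ i, MeasurableSet (L i)) :
    ∃ K, IsClosed K ∧ Disjoint (K ×ˢ K) T ∧ ∀ i ∈ F, ν (L i) ≤ 8 * ν (L i ∩ K) := by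
  obtain ⟨Y, hY, hYT, hYL⟩ := hT.exists_avoiding ν hν hC hνC F L hL
  have hcl : ∀ i, ∃ K ⊆ L i ∩ Y, IsClosed K ∧ ν (L i ∩ Y) ≤ 2 * ν K := by
    intro i
    rcases eq_or_ne (ν (L i ∩ Y)) 0 with h0 | h0
    · exact ⟨∅, Set.empty_subset _, isClosed_empty, by simp [h0]⟩
    · obtain ⟨K, hK, hKc, hlt⟩ := ((hL i).inter hY).exists_lt_isClosed_of_ne_top (μ := ν)
        (measure_ne_top _ _) (ENNReal.half_lt_self h0 (measure_ne_top _ _))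
      refine ⟨K, hK, hKc, ?_⟩
      rw [mul_comm]
      exact (ENNReal.div_le_iff_le_mul (by simp) (by simp)).1 hlt.le
  choose K hKL hKc hK using hcl
  have hKY : ⋃ i ∈ F, K i ⊆ Y := Set.iUnion₂_subset fun i _ => (hKL i).trans Set.inter_subset_right
  refine ⟨⋃ i ∈ F, K i, F.finite_toSet.isClosed_biUnion fun i _ => hKc i,
    hYT.mono_left (Set.prod_mono hKY hKY), fun i hi => ?_⟩
  have h1 : ν (L i) ≤ 4 * ν (L i ∩ Y) := by
    rw [← ENNReal.toReal_le_toReal (measure_ne_top _ _)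
      (ENNReal.mul_ne_top (by simp) (measure_ne_top _ _)), ENNReal.toReal_mul]
    exact hYL i hi
  calc ν (L i) ≤ 4 * (2 * ν (K i)) := h1.trans (by gcongr; exact hK i)
    _ = 8 * ν (K i) := by rw [← mul_assoc]; norm_num
    _ ≤ 8 * ν (L i ∩ ⋃ i ∈ F, K i) := by
      gcongr
      exact Set.subset_inter ((hKL i).trans Set.inter_subset_left)
        (Set.subset_biUnion_of_mem (u := fun i => K i) hi)

/-- A finite measure can be concentrated on a closed set which avoids a partial injection, so that
it increases by a bounded factor only and the masses of the cells of a finite partition, given as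
the fibers of `q`, do not change. -/
theorem IsPartialInjection.exists_concentrated {T : Set (X × X)} {B : Set X}
    (hT : IsPartialInjection T B) {ι : Type*} (ν : Measure X) [IsFiniteMeasure ν]
    (hν : ∀ x, ν {x} = 0) {C : Set X} (hC : IsCompact C) (hνC : ν Cᶜ = 0) (q : X → ι)
    (hq : ∀ V, MeasurableSet (q ⁻¹' V)) (hqC : (q '' C).Finite) :
    ∃ (ν' : Measure X) (K : Set X), IsClosed K ∧ Disjoint (K ×ˢ K) T ∧ ν' Kᶜ = 0 ∧
      ν' ≤ (8 : ℝ≥0∞) • ν ∧ ∀ V, ν' (q ⁻¹' V) = ν (q ⁻¹' V) := by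
  classical
  let F := hqC.toFinset
  let Q : ι → Set X := fun i => q ⁻¹' {i}
  have hQ : ∀ i, MeasurableSet (Q i) := fun i => hq _
  obtain ⟨K, hK, hKT, hKQ⟩ := hT.exists_isClosed_avoiding ν hν hC hνC F Q hQ
  have hQdisj : ∀ s : Set X, (F : Set ι).PairwiseDisjoint fun i => s ∩ Q i := by
    intro s i _ j _ hij
    refine Set.disjoint_left.2 fun x hi hj => hij ?_
    exact hi.2.symm.trans hj.2
  have hQsum : ∀ s, MeasurableSet s → ∑ i ∈ F, ν (s ∩ Q i) = ν s := by
    intro s hs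
    rw [← measure_biUnion_finset (hQdisj s) fun i _ => hs.inter (hQ i)]
    refine le_antisymm (measure_mono (Set.iUnion₂_subset fun i _ => Set.inter_subset_left)) ?_
    have : s ⊆ (⋃ i ∈ F, s ∩ Q i) ∪ Cᶜ := by
      intro x hx
      by_cases hxC : x ∈ C
      · exact Or.inl (Set.mem_iUnion₂.2 ⟨q x, hqC.mem_toFinset.2 ⟨x, hxC, rfl⟩, hx, rfl⟩)
      · exact Or.inr hxC
    exact (measure_mono this).trans ((measure_union_le _ _).trans (by rw [hνC, add_zero]))
  -- Factor that restores the mass of the cell `Q i`. If `ν (Q i ∩ K) = 0`, then `ν (Q i) = 0` by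
  -- `hKQ`, and the value `0 / 0 = 0` is harmless.
  let r : ι → ℝ≥0∞ := fun i => ν (Q i) / ν (Q i ∩ K)
  have hr : ∀ i ∈ F, r i ≤ 8 := fun i hi => ENNReal.div_le_of_le_mul (hKQ i hi)
  refine ⟨∑ i ∈ F, r i • ν.restrict (Q i ∩ K), K, hK, hKT, ?_, ?_, fun V => ?_⟩
  · rw [Measure.finsetSum_apply]
    refine Finset.sum_eq_zero fun i _ => ?_
    rw [Measure.smul_apply, Measure.restrict_apply hK.measurableSet.compl,
      show Kᶜ ∩ (Q i ∩ K) = ∅ by ext x; simp +contextual]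
    simp
  · refine Measure.le_iff.2 fun s hs => ?_
    rw [Measure.finsetSum_apply, Measure.smul_apply, ← hQsum s hs, smul_eq_mul, Finset.mul_sum]
    refine Finset.sum_le_sum fun i hi => ?_
    rw [Measure.smul_apply, Measure.restrict_apply hs, smul_eq_mul]
    exact mul_le_mul' (hr i hi) (measure_mono fun x hx => ⟨hx.1, hx.2.1⟩)
  · rw [Measure.finsetSum_apply, ← hQsum _ (hq V)]
    refine Finset.sum_congr rfl fun i hi => ?_
    rw [Measure.smul_apply, Measure.restrict_apply (hq V), smul_eq_mul]
    by_cases hiV : i ∈ V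
    · have hsub : Q i ⊆ q ⁻¹' V := by
        rintro x rfl
        exact hiV
      rw [Set.inter_eq_right.2 (Set.inter_subset_left.trans hsub), Set.inter_eq_right.2 hsub]
      refine ENNReal.div_mul_cancel' (fun h => ?_) (fun h => absurd h (measure_ne_top _ _))
      have := hKQ i hi
      rwa [h, mul_zero, nonpos_iff_eq_zero] at this
    · have hempty : q ⁻¹' V ∩ Q i = ∅ := by
        ext x
        simp only [Set.mem_inter_iff, Set.mem_empty_iff_false, iff_false]
        rintro ⟨h, rfl⟩
        exact hiV h
      rw [hempty, ← Set.inter_assoc, hempty, Set.empty_inter]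
      simp

end Thinning

/-! ### Iterated concentration along refining partitions -/

section Concentration

variable {X : Type*} [TopologicalSpace X] [PolishSpace X] [MeasurableSpace X] [BorelSpace X]

/-- Iteration of `IsPartialInjection.exists_concentrated` along finer and finer partitions. -/
theorem exists_seq_concentrated {T : ℕ → Set (X × X)} {B : ℕ → Set X}
    (hT : ∀ k, IsPartialInjection (T k) (B k)) {ι : Type*} (μ : Measure X) [IsFiniteMeasure μ]
    (hμ : ∀ x, μ {x} = 0) {C : Set X} (hC : IsCompact C) (hμC : μ Cᶜ = 0) (q : ℕ → X → ι)
    (hq : ∀ k V, MeasurableSet (q k ⁻¹' V)) (hqC : ∀ k, (q k '' C).Finite)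
    (hqq : ∀ j k, j ≤ k → ∃ φ : ι → ι, q j = φ ∘ q k) :
    ∃ (ν : ℕ → Measure X) (K : ℕ → Set X), (∀ k, IsClosed (K k)) ∧
      (∀ k, Disjoint (K k ×ˢ K k) (T k)) ∧ ν 0 = μ ∧ (∀ k, ν k ≤ (8 : ℝ≥0∞) ^ k • μ) ∧
      (∀ j k, j < k → ν k (K j)ᶜ = 0) ∧
      ∀ j k, j ≤ k → ∀ V, ν k (q j ⁻¹' V) = ν j (q j ⁻¹' V) := by
  -- The bound by a multiple of `μ` is carried along because it makes the next measure finite,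
  -- atomless and null off `C`.
  have hstep : ∀ (k : ℕ) (ν : {ν : Measure X // ν ≤ (8 : ℝ≥0∞) ^ k • μ}),
      ∃ (ν' : {ν : Measure X // ν ≤ (8 : ℝ≥0∞) ^ (k + 1) • μ}) (K : Set X), IsClosed K ∧
        Disjoint (K ×ˢ K) (T k) ∧ ν'.1 Kᶜ = 0 ∧ ν'.1 ≤ (8 : ℝ≥0∞) • ν.1 ∧
        ∀ V, ν'.1 (q k ⁻¹' V) = ν.1 (q k ⁻¹' V) := by
    rintro k ⟨ν, hν⟩
    have hle : ∀ s, ν s ≤ 8 ^ k * μ s := fun s => by simpa using hν s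
    have hfin : IsFiniteMeasure ν :=
      ⟨(hle _).trans_lt (ENNReal.mul_lt_top (ENNReal.pow_lt_top (by simp)) (measure_lt_top _ _))⟩
    have hzero : ∀ s, μ s = 0 → ν s = 0 := fun s hs => by simpa [hs] using hle s
    obtain ⟨ν', K, hK, hKT, hν'K, hν', hV⟩ := (hT k).exists_concentrated ν
      (fun x => hzero _ (hμ x)) hC (hzero _ hμC) (q k) (hq k) (hqC k)
    refine ⟨⟨ν', hν'.trans ?_⟩, K, hK, hKT, hν'K, hν', hV⟩
    rw [pow_succ', mul_smul]
    exact Measure.le_iff'.2 fun s => by simpa using mul_le_mul_right (hle s) 8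
  choose N K hK hKT hNK hN8 hNV using hstep
  let ν : (k : ℕ) → {ν : Measure X // ν ≤ (8 : ℝ≥0∞) ^ k • μ} := fun k =>
    Nat.rec ⟨μ, by simp⟩ (fun k ν => N k ν) k
  refine ⟨fun k => (ν k).1, fun k => K k (ν k), fun k => hK k _, fun k => hKT k _, rfl,
    fun k => (ν k).2, fun j k hjk => ?_, fun j k hjk V => ?_⟩
  · induction k, hjk using Nat.le_induction with
    | base => exact hNK j (ν j)
    | succ k hk ih => exact le_zero_iff.1 ((hN8 k (ν k) _).trans (by simp [ih]))
  · induction k, hjk using Nat.le_induction with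
    | base => rfl
    | succ k hk ih =>
      -- Cells of `q j` are unions of cells of the finer `q k`, whose masses stage `k` preserves.
      obtain ⟨φ, hφ⟩ := hqq j k hk
      refine Eq.trans ?_ ih
      dsimp only
      rw [hφ, Set.preimage_comp]
      exact hNV k (ν k) _

end Concentration

/-! ### Dyadic cubes and volume estimates -/

section Grid

variable {n : ℕ}

/-- The index of the dyadic cube of side `2⁻ᵐ` which contains a given point. -/
noncomputable def gridIndex (n m : ℕ) (x : EuclideanSpace ℝ (Fin n)) : Fin n → ℤ :=
  fun i => ⌊x i * 2 ^ m⌋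

theorem measurableSet_gridIndex_preimage (m : ℕ) (V : Set (Fin n → ℤ)) :
    MeasurableSet (gridIndex n m ⁻¹' V) := by
  have : Measurable (gridIndex n m) :=
    measurable_pi_iff.2 fun i => Int.measurable_floor.comp (by fun_prop)
  exact this V.to_countable.measurableSet

theorem gridIndex_eq_comp {m m' : ℕ} (h : m ≤ m') :
    ∃ φ : (Fin n → ℤ) → (Fin n → ℤ), gridIndex n m = φ ∘ gridIndex n m' := by
  refine ⟨fun z i => z i / (2 ^ (m' - m) : ℕ), ?_⟩
  ext x i
  simp only [gridIndex, Function.comp_apply]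
  rw [← Int.floor_div_natCast]
  congr 1
  rw [eq_div_iff (by positivity), Nat.cast_pow, Nat.cast_ofNat, mul_assoc, ← pow_add,
    Nat.add_sub_cancel' h]

theorem finite_gridIndex_image_unitCube (m : ℕ) : (gridIndex n m '' unitCube n).Finite := by
  refine (Set.finite_Icc (fun _ => 0 : Fin n → ℤ) (fun _ => 2 ^ m)).subset ?_
  rintro _ ⟨x, hx, rfl⟩
  refine ⟨fun i => Int.floor_nonneg.2 (mul_nonneg (hx i).1 (by positivity)), fun i => ?_⟩
  refine Int.floor_le_iff.2 ?_
  have := mul_le_mul_of_nonneg_right (hx i).2 (show (0 : ℝ) ≤ 2 ^ m by positivity)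
  push_cast
  linarith

theorem volume_box (a b : Fin n → ℝ) :
    volume {x : EuclideanSpace ℝ (Fin n) | ∀ i, x i ∈ Set.Icc (a i) (b i)} =
      ∏ i, ENNReal.ofReal (b i - a i) := by
  have := (PiLp.volume_preserving_ofLp (Fin n)).measure_preimage
    (s := Set.Icc a b) measurableSet_Icc.nullMeasurableSet
  rw [Real.volume_Icc_pi] at this
  rw [← this]
  congr 1
  ext x
  simp [Pi.le_def, forall_and]

theorem isClosed_unitCube : IsClosed (unitCube n) := by
  simp only [unitCube, Set.ofPred_forall]
  exact isClosed_iInter fun i => isClosed_Icc.preimage (by fun_prop)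

theorem volume_unitCube : volume (unitCube n) = 1 := by
  refine (volume_box (n := n) (fun _ => 0) (fun _ => 1)).trans ?_
  simp

theorem volume_cube (c : Fin n → ℝ) (d : ℝ≥0) :
    volume {x : EuclideanSpace ℝ (Fin n) | ∀ i, x i ∈ Set.Icc (c i - 2 * d) (c i + 2 * d)} =
      ((4 * d : ℝ≥0) : ℝ≥0∞) ^ n := by
  have h : ∀ i, ENNReal.ofReal (c i + 2 * d - (c i - 2 * d)) = ((4 * d : ℝ≥0) : ℝ≥0∞) := by
    intro i
    rw [← ENNReal.ofReal_coe_nnreal]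
    congr 1
    push_cast
    ring
  rw [volume_box, Finset.prod_congr rfl fun i _ => h i]
  simp

/-- A set of diameter at most `d` has volume at most `(4d)ⁿ`. -/
theorem volume_le_of_dist_le {U : Set (EuclideanSpace ℝ (Fin n))} {d : ℝ≥0}
    (hU : ∀ x ∈ U, ∀ y ∈ U, dist x y ≤ d) : volume U ≤ ((4 * d : ℝ≥0) : ℝ≥0∞) ^ n := by
  rcases U.eq_empty_or_nonempty with rfl | ⟨x₀, hx₀⟩
  · simp
  -- Half side `d` would do; `2 * d` gives the same bound as for the union of the dyadic cubes that
  -- meet `U`.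
  have hsub : U ⊆ {x | ∀ i, x i ∈ Set.Icc (x₀ i - 2 * d) (x₀ i + 2 * d)} := by
    intro x hx i
    have h1 := (PiLp.norm_apply_le (x - x₀) i).trans ((dist_eq_norm x x₀) ▸ hU x hx x₀ hx₀)
    rw [PiLp.sub_apply, Real.norm_eq_abs, abs_le] at h1
    constructor <;> linarith [h1.1, h1.2, d.coe_nonneg]
  exact (measure_mono hsub).trans (volume_cube _ _).le

/-- The dyadic cubes of side at most `d` which meet a set of diameter at most `d` have volume at
most `(4d)ⁿ`. -/
theorem volume_gridIndex_preimage_image_le {U : Set (EuclideanSpace ℝ (Fin n))} {d : ℝ≥0} {m : ℕ}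
    (hU : ∀ x ∈ U, ∀ y ∈ U, dist x y ≤ d) (hm : (1 / 2 : ℝ) ^ m ≤ d) :
    volume (gridIndex n m ⁻¹' (gridIndex n m '' U)) ≤ ((4 * d : ℝ≥0) : ℝ≥0∞) ^ n := by
  rcases U.eq_empty_or_nonempty with rfl | ⟨x₀, hx₀⟩
  · simp
  have hsub : gridIndex n m ⁻¹' (gridIndex n m '' U) ⊆
      {x | ∀ i, x i ∈ Set.Icc (x₀ i - 2 * d) (x₀ i + 2 * d)} := by
    rintro y ⟨x, hx, hxy⟩ i
    have h1 := (PiLp.norm_apply_le (x - x₀) i).trans ((dist_eq_norm x x₀) ▸ hU x hx x₀ hx₀)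
    rw [PiLp.sub_apply, Real.norm_eq_abs, abs_le] at h1
    have h2 := Int.abs_sub_lt_one_of_floor_eq_floor (congrFun hxy i)
    have h3 : |x i - y i| ≤ d := by
      refine le_trans ?_ hm
      rw [← sub_mul, abs_mul, abs_of_pos (show (0 : ℝ) < 2 ^ m by positivity)] at h2
      rw [one_div, inv_pow, ← one_div, le_div_iff₀ (by positivity)]
      exact h2.le
    rw [abs_le] at h3
    constructor <;> linarith [h1.1, h1.2, h3.1, h3.2]
  exact (measure_mono hsub).trans (volume_cube _ _).le

end Grid

/-! ### The compact transversal and mass distribution -/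

section Transversal

variable {n : ℕ}

theorem exists_strictMono_pow_le {δ : ℕ → ℝ} (hδ : ∀ k, 0 < δ k) :
    ∃ m : ℕ → ℕ, StrictMono m ∧ ∀ k, (1 / 2 : ℝ) ^ m k ≤ δ k := by
  refine Filter.extraction_forall_of_eventually' (P := fun k m => (1 / 2 : ℝ) ^ m ≤ δ k) fun k => ?_
  have := tendsto_pow_atTop_nhds_zero_of_lt_one (r := (1 / 2 : ℝ)) (by norm_num) (by norm_num)
  exact eventually_atTop.1 (this.eventually (ge_mem_nhds (hδ k)))

/-- If `t ^ n / g t → 0` then `g` dominates every multiple of `t ^ n` near `0`. -/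
theorem LowerOrder.exists_pos_mul_pow_le {g : ℝ≥0 → ℝ≥0} (hg : ∀ t, 0 < t → 0 < g t)
    (h : LowerOrder g (fun t => t ^ n)) {c : ℝ≥0} (hc : 0 < c) :
    ∃ δ : ℝ≥0, 0 < δ ∧ ∀ t, 0 < t → t < δ → c * t ^ n ≤ g t := by
  have := h.eventually (ge_mem_nhds (show 0 < c⁻¹ by positivity))
  obtain ⟨δ, hδ, hsub⟩ := (mem_nhdsGT_iff_exists_Ioo_subset).1 this
  refine ⟨δ, hδ, fun t ht0 htδ => ?_⟩
  have h1 : t ^ n / g t ≤ c⁻¹ := hsub ⟨ht0, htδ⟩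
  rw [div_le_iff₀ (hg t ht0)] at h1
  calc c * t ^ n ≤ c * (c⁻¹ * g t) := by gcongr
    _ = g t := by rw [← mul_assoc, mul_inv_cancel₀ hc.ne', one_mul]

/-- A countable Borel equivalence relation on `ℝⁿ` has a compact partial transversal in the unit
cube whose countable open covers by small sets have `g`-sums bounded away from zero. -/
theorem IsCountableBorel.exists_compact_transversal (hn : n ≠ 0)
    {E : Setoid (EuclideanSpace ℝ (Fin n))} (hE : IsCountableBorel E) {g : ℝ≥0 → ℝ≥0}
    (hg : ∀ t, 0 < t → 0 < g t) (hlow : LowerOrder g (fun t => t ^ n)) :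
    ∃ A : Set (EuclideanSpace ℝ (Fin n)), IsCompact A ∧ A ⊆ unitCube n ∧
      (∀ x ∈ A, ∀ y ∈ A, E x y → x = y) ∧ ∃ δ : ℝ≥0, 0 < δ ∧ 0 < gaugePreMeasure g δ A := by
  have : Nonempty (Fin n) := ⟨⟨0, Nat.pos_of_ne_zero hn⟩⟩
  have hfinQ : IsFiniteMeasure (volume.restrict (unitCube n)) := ⟨by simp [volume_unitCube]⟩
  obtain ⟨T, B, hT, G, hG, hG0, hGT⟩ := hE.exists_partialInjections (volume.restrict (unitCube n))
  have hQm : MeasurableSet (unitCube n) := isClosed_unitCube.measurableSet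
  have hvol : volume (unitCube n ∩ G) = 1 := by
    rw [Measure.restrict_apply hG.compl] at hG0
    have h1 := measure_inter_add_sdiff (μ := volume) (unitCube n) hG
    rw [Set.sdiff_eq, Set.inter_comm _ Gᶜ, hG0, add_zero, volume_unitCube] at h1
    exact h1
  obtain ⟨C, hCsub, hC, hCpos⟩ := (hQm.inter hG).exists_lt_isCompact_of_ne_top (μ := volume)
    (by simp [hvol]) (show 0 < volume (unitCube n ∩ G) by simp [hvol])
  have hCQ : C ⊆ unitCube n := hCsub.trans Set.inter_subset_left
  have hCfin : volume C < ⊤ := hC.measure_lt_top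
  set μ : Measure (EuclideanSpace ℝ (Fin n)) := volume.restrict C with hμdef
  have hμfin : IsFiniteMeasure μ := ⟨by simpa [hμdef] using hCfin⟩
  have hμle : ∀ s, μ s ≤ volume s := fun s => Measure.restrict_apply_le C s
  choose δ hδ hδg using fun k : ℕ => hlow.exists_pos_mul_pow_le hg (c := 8 ^ k) (by positivity)
  -- The shift matters: a diameter below `2 ^ (-m (j - 1))` is then below `δ j`, where `g` absorbs
  -- the factor `8 ^ j`.
  obtain ⟨m, hm, hmδ⟩ := exists_strictMono_pow_le (δ := fun k => (δ (k + 1) : ℝ))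
    fun k => NNReal.coe_pos.2 (hδ _)
  obtain ⟨ν, K, hK, hKT, hν0, hν, hνK, hνq⟩ := exists_seq_concentrated hT μ
    (fun x => le_zero_iff.1 ((hμle {x}).trans_eq (measure_singleton x))) hC
    (by rw [hμdef, Measure.restrict_apply hC.measurableSet.compl, Set.compl_inter_self,
      measure_empty]) (fun k => gridIndex n (m k))
    (fun k V => measurableSet_gridIndex_preimage _ V)
    (fun k => (finite_gridIndex_image_unitCube _).subset (Set.image_mono hCQ))
    (fun j k hjk => gridIndex_eq_comp (hm.monotone hjk))
  have hνle : ∀ k s, ν k s ≤ 8 ^ k * volume s := fun k s =>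
    (hν k s).trans (by simpa using mul_le_mul_right (hμle s) _)
  have hbound : ∀ k (U : Set (EuclideanSpace ℝ (Fin n))), Metric.ediam U < δ 0 →
      ν k U ≤ 4 ^ n * g (Metric.ediam U).toNNReal := by
    intro k U hU
    have hUtop : Metric.ediam U ≠ ⊤ := hU.ne_top
    set d : ℝ≥0 := (Metric.ediam U).toNNReal with hd
    have hdU : ((d : ℝ≥0) : ℝ≥0∞) = Metric.ediam U := ENNReal.coe_toNNReal hUtop
    have hdist : ∀ x ∈ U, ∀ y ∈ U, dist x y ≤ d := by
      intro x hx y hy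
      rw [← coe_nndist, NNReal.coe_le_coe, ← ENNReal.coe_le_coe, ← edist_nndist, hdU]
      exact Metric.edist_le_ediam_of_mem hx hy
    have hmul : ∀ j, (8 : ℝ≥0∞) ^ j * ((4 * d : ℝ≥0) : ℝ≥0∞) ^ n =
        4 ^ n * ((8 ^ j * d ^ n : ℝ≥0) : ℝ≥0∞) := by
      intro j
      push_cast
      rw [mul_pow]
      ring
    rcases eq_or_ne d 0 with hd0 | hd0
    · refine (hνle k U).trans ((mul_le_mul_right (volume_le_of_dist_le hdist) _).trans ?_)
      simp [hd0, hn]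
    have hd0' : 0 < d := pos_iff_ne_zero.2 hd0
    have hex : ∃ j, (1 / 2 : ℝ) ^ m j ≤ d := by
      have h1 := (tendsto_pow_atTop_nhds_zero_of_lt_one (r := (1 / 2 : ℝ)) (by norm_num)
        (by norm_num)).comp hm.tendsto_atTop
      exact (h1.eventually (ge_mem_nhds (NNReal.coe_pos.2 hd0'))).exists
    classical
    -- The first stage whose dyadic cubes have side at most `d`.
    set j := Nat.find hex with hj
    have hjd : (1 / 2 : ℝ) ^ m j ≤ d := Nat.find_spec hex
    have hgd : 8 ^ j * d ^ n ≤ g d := by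
      refine hδg j d hd0' ?_
      rcases Nat.eq_zero_or_pos j with h0 | hpos
      · rw [h0]
        rwa [← ENNReal.coe_lt_coe, hdU]
      · have h1 := Nat.find_min hex (m := j - 1) (by omega)
        have h2 := hmδ (j - 1)
        rw [Nat.sub_add_cancel hpos] at h2
        exact NNReal.coe_lt_coe.1 ((not_le.1 h1).trans_le h2)
    have hfinal : (8 : ℝ≥0∞) ^ j * ((4 * d : ℝ≥0) : ℝ≥0∞) ^ n ≤ 4 ^ n * g d := by
      rw [hmul j]
      gcongr
    refine le_trans ?_ hfinal
    -- From stage `j` on, cubes of side `2 ^ (-m j)` keep their `ν j` mass. Before stage `j`, the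
    -- bound `ν k ≤ 8 ^ k • volume` is already good enough.
    rcases le_or_gt j k with hjk | hkj
    · calc ν k U ≤ ν k (gridIndex n (m j) ⁻¹' (gridIndex n (m j) '' U)) :=
            measure_mono (Set.subset_preimage_image _ _)
        _ = ν j (gridIndex n (m j) ⁻¹' (gridIndex n (m j) '' U)) := hνq j k hjk _
        _ ≤ _ := (hνle j _).trans
            (mul_le_mul_right (volume_gridIndex_preimage_image_le hdist hjd) _)
    · refine (hνle k U).trans (mul_le_mul' ?_ (volume_le_of_dist_le hdist))
      exact pow_le_pow_right₀ (by norm_num) hkj.le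
  let A : ℕ → Set (EuclideanSpace ℝ (Fin n)) := fun l => C ∩ ⋂ k ∈ Set.Iio l, K k
  have hAc : ∀ l, IsCompact (A l) := fun l => hC.inter_right (isClosed_biInter fun k _ => hK k)
  have hAmono : ∀ {l l'}, l ≤ l' → A l' ⊆ A l := fun h => Set.inter_subset_inter_right _
    (Set.biInter_subset_biInter_left fun k hk => lt_of_lt_of_le hk h)
  have hνA : ∀ l, ν l (A l)ᶜ = 0 := by
    intro l
    have h1 : ν l Cᶜ = 0 := by
      refine le_zero_iff.1 ((hν l _).trans ?_)
      simp [hμdef, Measure.restrict_apply hC.measurableSet.compl]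
    have h2 : (A l)ᶜ ⊆ Cᶜ ∪ ⋃ k ∈ Set.Iio l, (K k)ᶜ := by
      intro x hx
      by_contra hcon
      refine hx ⟨?_, ?_⟩
      · by_contra h
        exact hcon (Or.inl h)
      · refine Set.mem_iInter₂.2 fun k hk => ?_
        by_contra h
        exact hcon (Or.inr (Set.mem_iUnion₂.2 ⟨k, hk, h⟩))
    refine measure_mono_null h2 (measure_union_null h1 ?_)
    exact (measure_biUnion_null_iff (Set.to_countable _)).2 fun k hk => hνK k l hk
  have hνuniv : ∀ l, ν l (A l) = volume C := by
    intro l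
    have h1 := measure_add_measure_compl (μ := ν l) (hAc l).measurableSet
    have h2 := hνq 0 l (Nat.zero_le _) Set.univ
    rw [Set.preimage_univ, hν0, Measure.restrict_apply_univ] at h2
    rwa [hνA, add_zero, h2] at h1
  refine ⟨⋂ l, A l, (hAc 0).of_isClosed_subset (isClosed_iInter fun l => (hAc l).isClosed)
    (Set.iInter_subset _ 0), (Set.iInter_subset _ 0).trans
    (Set.inter_subset_left.trans hCQ), ?_, δ 0, hδ 0, ?_⟩
  · intro x hx y hy hxy
    by_contra hne
    have hG' : ∀ z ∈ ⋂ l, A l, z ∈ G := fun z hz => (hCsub (Set.mem_iInter.1 hz 0).1).2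
    obtain ⟨k, hk⟩ := hGT x (hG' x hx) y (hG' y hy) hxy hne
    have hK' : ∀ z ∈ ⋂ l, A l, z ∈ K k := fun z hz =>
      Set.mem_iInter₂.1 (Set.mem_iInter.1 hz (k + 1)).2 k (Nat.lt_succ_self k)
    exact Set.disjoint_left.1 (hKT k) ⟨hK' x hx, hK' y hy⟩ hk
  · refine lt_of_lt_of_le (ENNReal.div_pos hCpos.ne' (show (4 : ℝ≥0∞) ^ n ≠ ⊤ by finiteness)) ?_
    refine le_iInf fun U => le_iInf fun hU => le_iInf fun hAU => le_iInf fun hUd => ?_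
    -- By compactness the open cover of the intersection already covers some `A l`, which carries
    -- the whole mass `volume C` of `ν l`.
    obtain ⟨l, hl⟩ := exists_subset_nhds_of_isCompact (V := A)
      (directed_of_isDirected_le fun _ _ h => hAmono h) hAc (U := ⋃ i, U i)
      fun x hx => (isOpen_iUnion hU).mem_nhds (hAU hx)
    refine ENNReal.div_le_of_le_mul' ?_
    rw [← ENNReal.tsum_mul_left, ← hνuniv l]
    exact (measure_mono hl).trans ((measure_iUnion_le _).trans
      (ENNReal.tsum_le_tsum fun i => hbound l (U i) (hUd i)))

end Transversal

/-! ### From gauge premeasures to Hausdorff dimension -/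

section Dimension

/-- If `g t ≤ t ^ s` near `0`, then positivity of a `g`-premeasure implies that the dimension is at
least `s`. -/
theorem le_dimH_of_gaugePreMeasure_pos {X : Type*} [MetricSpace X] {A : Set X}
    {g : ℝ≥0 → ℝ≥0} {δ s : ℝ≥0} (hδ : 0 < δ) (hA : 0 < gaugePreMeasure g δ A)
    (hgs : ∀ t, t < δ → g t ≤ t ^ (s : ℝ)) : (s : ℝ≥0∞) ≤ dimH A := by
  borelize X
  rcases eq_or_ne s 0 with rfl | hs
  · simp
  refine le_dimH_of_hausdorffMeasure_ne_zero fun h0 => ?_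
  obtain ⟨ε, hε, hεA⟩ := exists_between hA
  have hε2 : ε / 2 ≠ 0 := (ENNReal.half_pos hε.ne').ne'
  rw [Measure.hausdorffMeasure_apply, ENNReal.iSup_eq_zero] at h0
  have h1 := (ENNReal.iSup_eq_zero.1 (h0 (δ / 2 : ℝ≥0))) (by exact_mod_cast half_pos hδ)
  have h2 : _ < ε / 2 := h1.trans_lt (pos_iff_ne_zero.2 hε2)
  simp only [iInf_lt_iff] at h2
  obtain ⟨t, hAt, htd, hsum⟩ := h2
  obtain ⟨e, he, hesum⟩ := ENNReal.exists_pos_sum_of_countable hε2 ℕ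
  -- Covers for the Hausdorff measure consist of arbitrary sets; a slight thickening makes them open
  -- at total cost at most `ε / 2`. The radius `δ / 2` used for them leaves room below `δ`.
  have hU : ∀ i, ∃ U : Set X, IsOpen U ∧ t i ⊆ U ∧ Metric.ediam U < δ ∧
      (Metric.ediam U) ^ (s : ℝ) ≤ (⨆ _ : (t i).Nonempty, Metric.ediam (t i) ^ (s : ℝ)) + e i := by
    intro i
    rcases (t i).eq_empty_or_nonempty with hem | hne
    · refine ⟨∅, isOpen_empty, hem.subset, by simpa using hδ, ?_⟩
      rw [Metric.ediam_empty, ENNReal.zero_rpow_of_pos (by exact_mod_cast pos_iff_ne_zero.2 hs)]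
      exact zero_le
    · have hdlt : Metric.ediam (t i) < δ :=
        (htd i).trans_lt (by exact_mod_cast half_lt_self hδ)
      have hlim : Tendsto (fun η : ℝ => Metric.ediam (t i) + 2 * ENNReal.ofReal η) (𝓝[>] 0)
          (𝓝 (Metric.ediam (t i))) := by
        have h3 : Continuous fun η : ℝ => Metric.ediam (t i) + 2 * ENNReal.ofReal η :=
          continuous_const.add ((ENNReal.continuous_const_mul (by simp)).comp
            ENNReal.continuous_ofReal)
        have h4 := h3.tendsto 0
        rw [ENNReal.ofReal_zero, mul_zero, add_zero] at h4
        exact h4.mono_left nhdsWithin_le_nhds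
      have hpow := ((ENNReal.continuous_rpow_const (y := (s : ℝ))).tendsto _).comp hlim
      have hlt : Metric.ediam (t i) ^ (s : ℝ) < Metric.ediam (t i) ^ (s : ℝ) + e i :=
        ENNReal.lt_add_right (ENNReal.rpow_ne_top_of_nonneg s.coe_nonneg hdlt.ne_top)
          (by exact_mod_cast (he i).ne')
      obtain ⟨η, ⟨hη1, hη2⟩, hη0⟩ := (((hlim.eventually (gt_mem_nhds hdlt)).and
        (hpow.eventually (gt_mem_nhds hlt))).and self_mem_nhdsWithin).exists
      have hth : Metric.ediam (Metric.thickening η (t i)) ≤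
          Metric.ediam (t i) + 2 * ENNReal.ofReal η := by
        have := Metric.ediam_thickening_le (s := t i) η.toNNReal
        rwa [Real.coe_toNNReal _ (le_of_lt hη0)] at this
      refine ⟨Metric.thickening η (t i), Metric.isOpen_thickening,
        Metric.self_subset_thickening hη0 _, hth.trans_lt hη1, ?_⟩
      rw [iSup_pos hne]
      exact (ENNReal.rpow_le_rpow hth s.coe_nonneg).trans (le_of_lt hη2)
  choose U hUo htU hUd hUs using hU
  have hle : gaugePreMeasure g δ A ≤ ∑' i, (g (Metric.ediam (U i)).toNNReal : ℝ≥0∞) :=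
    iInf_le_of_le U (iInf_le_of_le hUo (iInf_le_of_le
      (hAt.trans (Set.iUnion_mono htU)) (iInf_le_of_le hUd le_rfl)))
  refine hεA.not_ge (hle.trans ?_)
  calc ∑' i, (g (Metric.ediam (U i)).toNNReal : ℝ≥0∞)
      ≤ ∑' i, ((⨆ _ : (t i).Nonempty, Metric.ediam (t i) ^ (s : ℝ)) + e i) := by
        refine ENNReal.tsum_le_tsum fun i => le_trans ?_ (hUs i)
        have hd := ENNReal.coe_toNNReal (hUd i).ne_top
        have h5 := hgs (Metric.ediam (U i)).toNNReal (by rw [← ENNReal.coe_lt_coe, hd]; exact hUd i)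
        calc (g (Metric.ediam (U i)).toNNReal : ℝ≥0∞)
            ≤ (((Metric.ediam (U i)).toNNReal ^ (s : ℝ) : ℝ≥0) : ℝ≥0∞) := by exact_mod_cast h5
          _ = _ := by rw [ENNReal.coe_rpow_of_nonneg _ s.coe_nonneg, hd]
    _ = (∑' i, ⨆ _ : (t i).Nonempty, Metric.ediam (t i) ^ (s : ℝ)) + ∑' i, (e i : ℝ≥0∞) :=
        ENNReal.tsum_add
    _ ≤ ε / 2 + ε / 2 := add_le_add hsum.le hesum.le
    _ = ε := ENNReal.add_halves ε

theorem gaugePreMeasure_anti {X : Type*} [PseudoEMetricSpace X] (g : ℝ≥0 → ℝ≥0) (A : Set X) :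
    Antitone fun δ => gaugePreMeasure g δ A := by
  intro δ δ' h
  refine le_iInf fun U => le_iInf fun hU => le_iInf fun hA => le_iInf fun hd => ?_
  exact iInf_le_of_le U (iInf_le_of_le hU (iInf_le_of_le hA (iInf_le_of_le
    (fun i => (hd i).trans_le (by exact_mod_cast h)) le_rfl)))

/-- The function `tⁿ (1 + |log t|)`. -/
noncomputable def logGauge (n : ℕ) (t : ℝ≥0) : ℝ≥0 :=
  t ^ n * (1 + Real.nnabs (Real.log t))

theorem logGauge_pos {n : ℕ} {t : ℝ≥0} (ht : 0 < t) : 0 < logGauge n t := by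
  unfold logGauge
  positivity

theorem tendsto_coe_nhdsGT_zero :
    Tendsto (fun t : ℝ≥0 => (t : ℝ)) (𝓝[>] 0) (𝓝[>] 0) :=
  tendsto_nhdsWithin_iff.2 ⟨(NNReal.continuous_coe.tendsto' 0 0 rfl).mono_left nhdsWithin_le_nhds,
    eventually_mem_nhdsWithin.mono fun _ ht => NNReal.coe_pos.2 ht⟩

/-- The quotient is `1 / (1 + |log t|)`. -/
theorem lowerOrder_logGauge (n : ℕ) : LowerOrder (logGauge n) (fun t => t ^ n) := by
  have h1 : Tendsto (fun t : ℝ≥0 => 1 + |Real.log t|) (𝓝[>] 0) atTop :=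
    tendsto_atTop_add_const_left _ _
      (tendsto_abs_atBot_atTop.comp (Real.tendsto_log_nhdsGT_zero.comp tendsto_coe_nhdsGT_zero))
  rw [LowerOrder, ← NNReal.tendsto_coe]
  refine h1.inv_tendsto_atTop.congr' ?_
  filter_upwards [self_mem_nhdsWithin] with t ht
  have ht0 : (t : ℝ) ≠ 0 := (NNReal.coe_pos.2 ht).ne'
  have h2 : (1 : ℝ) + |Real.log t| ≠ 0 := by positivity
  simp only [logGauge, Pi.inv_apply]
  push_cast
  field_simp

/-- Division by `t ^ s` leaves `t ^ (n - s) * (1 + |log t|)`, and the positive power beats the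
logarithm. -/
theorem eventually_logGauge_le {n : ℕ} {s : ℝ≥0} (hs : s < n) :
    ∀ᶠ t in 𝓝[>] (0 : ℝ≥0), logGauge n t ≤ t ^ (s : ℝ) := by
  have hpos : (0 : ℝ) < n - s := sub_pos.2 (by exact_mod_cast hs)
  have h1 : Tendsto (fun t : ℝ => t ^ ((n : ℝ) - s) + |Real.log t * t ^ ((n : ℝ) - s)|) (𝓝[>] 0)
      (𝓝 (0 + |0|)) := by
    refine Tendsto.add ?_ (tendsto_log_mul_rpow_nhdsGT_zero hpos).abs
    have := (Real.continuous_rpow_const hpos.le).tendsto 0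
    rw [Real.zero_rpow hpos.ne'] at this
    exact this.mono_left nhdsWithin_le_nhds
  rw [abs_zero, add_zero] at h1
  filter_upwards [(h1.comp tendsto_coe_nhdsGT_zero).eventually (ge_mem_nhds one_pos),
    self_mem_nhdsWithin] with t ht ht0
  have ht0 : 0 < (t : ℝ) := NNReal.coe_pos.2 ht0
  have hp : 0 < (t : ℝ) ^ ((n : ℝ) - s) := Real.rpow_pos_of_pos ht0 _
  rw [Function.comp_apply, abs_mul, abs_of_pos hp] at ht
  rw [← NNReal.coe_le_coe, logGauge]
  push_cast
  rw [← Real.rpow_natCast, ← sub_add_cancel (n : ℝ) s, Real.rpow_add ht0]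
  have := mul_le_mul_of_nonneg_right ht (Real.rpow_pos_of_pos ht0 (s : ℝ)).le
  linarith

theorem le_dimH_of_logGauge_pos {X : Type*} [MetricSpace X] {n : ℕ} (hn : n ≠ 0) {A : Set X}
    {δ : ℝ≥0} (hδ : 0 < δ) (hA : 0 < gaugePreMeasure (logGauge n) δ A) : (n : ℝ≥0∞) ≤ dimH A := by
  refine ENNReal.le_of_forall_nnreal_lt fun s hs => ?_
  obtain ⟨δ', hδ', hsub⟩ := (mem_nhdsGT_iff_exists_Ioo_subset).1
    (eventually_logGauge_le (n := n) (s := s) (by exact_mod_cast hs))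
  refine le_dimH_of_gaugePreMeasure_pos (lt_min hδ hδ')
    (hA.trans_le (gaugePreMeasure_anti _ _ (min_le_left δ δ'))) fun t ht => ?_
  rcases eq_or_ne t 0 with rfl | ht0
  · simp [logGauge, hn]
  · exact hsub ⟨pos_iff_ne_zero.2 ht0, ht.trans_le (min_le_right _ _)⟩

end Dimension

/-- On such a set `E` is equality, so a Borel embedding of `X` into `ℝ` is a reduction. -/
theorem isSmooth_restrictSetoid {X : Type*} [MeasurableSpace X] [StandardBorelSpace X]
    {E : Setoid X} {A : Set X} (hA : ∀ x ∈ A, ∀ y ∈ A, E x y → x = y) :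
    IsSmooth (restrictSetoid E A) := by
  refine ⟨fun x => embeddingReal X x, (measurable_embeddingReal X).comp measurable_subtype_coe,
    fun x y => ⟨fun h => congrArg _ (hA x x.2 y y.2 h), fun h => ?_⟩⟩
  have : (x : X) = y := (measurableEmbedding_embeddingReal X).injective h
  change E x y
  rw [this]

theorem corollary4p3 (n : ℕ) (E : Setoid (EuclideanSpace ℝ (Fin n))) (hE : IsCountableBorel E) :
    (∀ g : ℝ≥0 → ℝ≥0, IsGauge g → LowerOrder g (fun t => t ^ n) →
      ∃ A : Set (EuclideanSpace ℝ (Fin n)), IsClosed A ∧ A ⊆ unitCube n ∧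
        IsSmooth (restrictSetoid E A) ∧ 0 < gaugeMeasure g A) ∧
    ∃ A : Set (EuclideanSpace ℝ (Fin n)), IsClosed A ∧ A ⊆ unitCube n ∧
      IsSmooth (restrictSetoid E A) ∧ dimH A = n := by
  rcases eq_or_ne n 0 with rfl | hn
  · refine ⟨fun g hg hlow => ?_, unitCube 0, isClosed_unitCube, subset_rfl,
      isSmooth_restrictSetoid fun x _ y _ _ => Subsingleton.elim x y, ?_⟩
    · -- no gauge function has lower order than a constant
      exfalso
      have h1 : Tendsto g (𝓝[>] 0) (𝓝 0) := by
        have := (hg.rightContinuous 0).mono_left (nhdsWithin_mono 0 Set.Ioi_subset_Ici_self)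
        rwa [hg.map_zero] at this
      have h2 := h1.mul hlow
      rw [zero_mul] at h2
      refine one_ne_zero (tendsto_nhds_unique (tendsto_const_nhds.congr' ?_) h2)
      filter_upwards [self_mem_nhdsWithin] with t ht
      rw [pow_zero, mul_one_div_cancel (hg.pos t ht).ne']
    · simpa using dimH_subsingleton (Set.subsingleton_of_subsingleton (s := unitCube 0))
  constructor
  · intro g hg hlow
    obtain ⟨A, hA, hAQ, hAE, δ, hδ, hpos⟩ := hE.exists_compact_transversal hn hg.pos hlow
    exact ⟨A, hA.isClosed, hAQ, isSmooth_restrictSetoid hAE,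
      hpos.trans_le (le_iSup₂ (f := fun (δ : ℝ≥0) (_ : 0 < δ) => gaugePreMeasure g δ A) δ hδ)⟩
  · obtain ⟨A, hA, hAQ, hAE, δ, hδ, hpos⟩ := hE.exists_compact_transversal hn
      (fun t => logGauge_pos) (lowerOrder_logGauge n)
    refine ⟨A, hA.isClosed, hAQ, isSmooth_restrictSetoid hAE,
      le_antisymm ?_ (le_dimH_of_logGauge_pos hn hδ hpos)⟩
    refine (dimH_mono (Set.subset_univ A)).trans ?_
    rw [Real.dimH_univ_eq_finrank]
    simp
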